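/- **Conventions.** A surreal number $x$ is a map $x:\ell(x)\to\{-1,1\}$ from an ordinal $\ell(x)$, its length, written $\beta\mapsto x[\beta]$ and extended by $x[\beta]=0$ for $\beta\ge\ell(x)$. The class $\mathbf{No}$ of all surreal numbers is ordered lexicographically. We write $x\sqsubseteq y$ ($x$ is simpler than $y$) if the sign sequence of $x$ is an initial segment of that of $y$, and a class $\mathbf C$ of numbers has root $x$ if $x\in\mathbf C$ and $x\sqsubseteq y$ for all $y\in\mathbf C$. For sets $L<R$ of numbers, $\{L\,|\,R\}$ is the root of the class of numbers $x$ with $L<x<R$. With $x_L$ (resp. $x_R$) the set of strictly simpler numbers smaller (resp. larger) than $x$, addition is defined by $x+y=\{x_L+y,\,x+y_L\,|\,x_R+y,\,x+y_R\}$. An ordinal $\alpha$ is identified with the constant sign sequence $+1$ of length $\alpha$. Below, $\dot\omega^{\alpha}$ is the ordinal power, and all sums and products of ordinals are ordinal sums and products. * The concatenation product $x\mathbin{\dot\times}y$ has length $\ell(x)\ell(y)$ and signs $(x\mathbin{\dot\times}y)[\ell(x)\alpha+\beta]=y[\alpha]\,x[\beta]$ for $\alpha<\ell(y)$, $\beta<\ell(x)$;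 and $a\mathbin{\dot\times}\mathbf{No}=\{a\mathbin{\dot\times}x:x\in\mathbf{No}\}$. The class of purely infinite numbers is $\mathbf{No}_\succ=\omega\mathbin{\dot\times}\mathbf{No}$. * A surreal substructure $\mathbf S$ is the image of an embedding of $(\mathbf{No},\le,\sqsubseteq)$ into itself; this embedding is unique and denoted $\Xi_{\mathbf S}$. The imbrication of $\mathbf T$ into $\mathbf S$ is $\mathbf S\prec\mathbf T=\Xi_{\mathbf S}(\mathbf T)$. The transfinite self-imbrications of $\mathbf S$ are $\mathbf S^{\prec0}=\mathbf{No}$, $\mathbf S^{\prec(\beta+1)}=\mathbf S^{\prec\beta}\prec\mathbf S$, and $\mathbf S^{\prec\alpha}=\bigcap_{\beta<\alpha}\mathbf S^{\prec\beta}$ for limit ordinals $\alpha>0$. * $\mathbf{No}(\gamma)=\{x:\ell(x)<\gamma\}$. For a set $A$ of numbers, $\mathcal T_A$ is the set of translations $x\mapsto x+c$, $c\in A$. For a set-sized group $\mathcal G$ of strictly increasing bijections of $\mathbf{No}$, a number $x$ is $\mathcal G$-simple if it is the root of its halo $\mathcal G[x]=\{y:\exists g,h\in\mathcal G,\ gx\le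 y\le hx\}$, and $\mathbf{Smp}_{\mathcal G}$ is the class of $\mathcal G$-simple numbers. **Proposition 7.2.** For every ordinal $\alpha$, the set $\mathcal T_{\mathbf{No}(\dot\omega^\alpha)}$ is a set-sized group of strictly increasing bijections of $\mathbf{No}$, and $$\mathbf{No}_\succ^{\prec\alpha}=\dot\omega^{\alpha}\mathbin{\dot\times}\mathbf{No}=\mathbf{Smp}_{\mathcal T_{\mathbf{No}(\dot\omega^\alpha)}}.$$ -/

import Mathlib

universe u

/-- A surreal number, given by its sign sequence: a map from an ordinal `length` to `{-1, 1}`,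
extended by `0` to all ordinals. The ordinals of the universe `u` play the role of `On`, and
subsets `Set No.{u}` play the role of classes of surreal numbers. -/
@[ext]
structure No : Type (u + 1) where
  /-- The length of the sign sequence. -/
  length : Ordinal.{u}
  /-- The sign sequence, padded with zeros. -/
  sign : Ordinal.{u} → SignType
  /-- The signs are nonzero exactly at the ordinals below the length. -/
  sign_ne_zero_iff : ∀ β, sign β ≠ 0 ↔ β < length

namespace No

theorem sign_injective : Function.Injective No.sign.{u} := by
  intro x y h
  have hl : x.length = y.length := by
    refine eq_of_forall_lt_iff fun β => ?_
    rw [← x.sign_ne_zero_iff, ← y.sign_ne_zero_iff, h]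
  exact No.ext hl h

/-- The order on surreal numbers is the lexicographic order of the padded sign sequences. -/
noncomputable instance : LinearOrder No.{u} :=
  LinearOrder.lift' (fun x => toLex x.sign) sign_injective

theorem lt_iff {x y : No.{u}} :
    x < y ↔ ∃ α, (∀ β < α, x.sign β = y.sign β) ∧ x.sign α < y.sign α :=
  Iff.rfl

/-- `x.Simpler y`, that is `x ⊑ y`: the sign sequence of `x` is an initial segment of that
of `y`. This relation is reflexive. -/
def Simpler (x y : No.{u}) : Prop :=
  ∀ β < x.length, x.sign β = y.sign β

/-- The ordinal `α` as a surreal number: the constant sign sequence `+1` of length `α`. -/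
noncomputable def ofOrdinal (α : Ordinal.{u}) : No.{u} where
  length := α
  sign β := if β < α then 1 else 0
  sign_ne_zero_iff β := by
    by_cases h : β < α <;> simp [h]

/-- The concatenation product: the number of length `ℓ(x) * ℓ(y)` (ordinal product) whose sign at
`ℓ(x) * α + β`, for `α < ℓ(y)` and `β < ℓ(x)`, is `y[α] * x[β]`. -/
noncomputable def concatMul (x y : No.{u}) : No.{u} where
  length := x.length * y.length
  sign γ := y.sign (γ / x.length) * x.sign (γ % x.length)
  sign_ne_zero_iff γ := by
    rw [mul_ne_zero_iff, y.sign_ne_zero_iff, x.sign_ne_zero_iff]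
    by_cases h : x.length = 0
    · simp [h]
    · rw [← Ordinal.lt_mul_iff_div_lt h]
      exact and_iff_left (Ordinal.mod_lt γ h)

theorem concatMul_sign {x y : No.{u}} {α β : Ordinal.{u}} (hβ : β < x.length) :
    (concatMul x y).sign (x.length * α + β) = y.sign α * x.sign β := by
  have h : x.length ≠ 0 := (pos_of_gt hβ).ne'
  simp [concatMul, Ordinal.mul_add_div _ h, Ordinal.div_eq_zero_of_lt hβ,
    Ordinal.mod_eq_of_lt hβ]

/-- `IsRoot C x`: the number `x` is the simplest element of the class `C`. -/
def IsRoot (C : Set No.{u}) (x : No.{u}) : Prop :=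
  x ∈ C ∧ ∀ y ∈ C, x.Simpler y

theorem IsRoot.unique {C : Set No.{u}} {x y : No.{u}} (hx : IsRoot C x) (hy : IsRoot C y) :
    x = y := by
  have h₁ := hx.2 y hy.1
  have h₂ := hy.2 x hx.1
  refine sign_injective (funext fun β => ?_)
  by_cases h : β < x.length
  · exact h₁ β h
  · by_cases h' : β < y.length
    · exact (h₂ β h').symm
    · have e₁ := (not_congr (x.sign_ne_zero_iff β)).2 h
      have e₂ := (not_congr (y.sign_ne_zero_iff β)).2 h'
      rw [not_not.1 e₁, not_not.1 e₂]

/-- The cut `(L | R)`: the class of all numbers strictly between `L` and `R`. -/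
def cut (L R : Set No.{u}) : Set No.{u} :=
  {x | (∀ l ∈ L, l < x) ∧ ∀ r ∈ R, x < r}

open Classical in
/-- The Conway bracket `{L | R}`: the simplest number strictly between `L` and `R`. (It exists
whenever `L < R` are sets, that is, small classes; the value is `0` if there is no such number.) -/
noncomputable def bracket (L R : Set No.{u}) : No.{u} :=
  if h : ∃ x, IsRoot (cut L R) x then h.choose else ofOrdinal 0

/-- The left options of `x`: the numbers `a < x` that are strictly simpler than `x`. -/
def leftOptions (x : No.{u}) : Set No.{u} :=
  {a | a.Simpler x ∧ a < x}

/-- The right options of `x`: the numbers `a > x` that are strictly simpler than `x`. -/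
def rightOptions (x : No.{u}) : Set No.{u} :=
  {a | a.Simpler x ∧ x < a}

theorem Simpler.length_lt {a x : No.{u}} (h : a.Simpler x) (hne : a ≠ x) :
    a.length < x.length := by
  by_contra hl
  rw [not_lt] at hl
  refine hne (sign_injective (funext fun β => ?_))
  by_cases hβ : β < a.length
  · exact h β hβ
  · have e₁ := (not_congr (a.sign_ne_zero_iff β)).2 hβ
    have e₂ := (not_congr (x.sign_ne_zero_iff β)).2 fun h' => hβ (h'.trans_le hl)
    rw [not_not.1 e₁, not_not.1 e₂]

theorem length_lt_of_mem_leftOptions {a x : No.{u}} (h : a ∈ leftOptions x) :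
    a.length < x.length :=
  Simpler.length_lt h.1 h.2.ne

theorem length_lt_of_mem_rightOptions {a x : No.{u}} (h : a ∈ rightOptions x) :
    a.length < x.length :=
  Simpler.length_lt h.1 h.2.ne'

/-- Conway's addition, `x + y = {x_L + y, x + y_L | x_R + y, x + y_R}`. -/
noncomputable def add (x y : No.{u}) : No.{u} :=
  bracket
    ({z | ∃ a, ∃ _ : a ∈ leftOptions x, z = add a y} ∪
      {z | ∃ b, ∃ _ : b ∈ leftOptions y, z = add x b})
    ({z | ∃ a, ∃ _ : a ∈ rightOptions x, z = add a y} ∪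
      {z | ∃ b, ∃ _ : b ∈ rightOptions y, z = add x b})
termination_by (x.length, y.length)
decreasing_by
  · exact Prod.Lex.left _ _ (length_lt_of_mem_leftOptions ‹_›)
  · exact Prod.Lex.right _ (length_lt_of_mem_leftOptions ‹_›)
  · exact Prod.Lex.left _ _ (length_lt_of_mem_rightOptions ‹_›)
  · exact Prod.Lex.right _ (length_lt_of_mem_rightOptions ‹_›)

noncomputable instance : Add No.{u} := ⟨add⟩

theorem add_eq (x y : No.{u}) :
    x + y = bracket ((· + y) '' leftOptions x ∪ (x + ·) '' leftOptions y)
      ((· + y) '' rightOptions x ∪ (x + ·) '' rightOptions y) := by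
  change add x y = _
  rw [add]
  congr 2 <;> ext z <;> simp only [Set.mem_ofPred_eq, Set.mem_image, exists_prop] <;>
    exact exists_congr fun a => and_congr_right fun _ => eq_comm

/-- An embedding of `(No, ≤, ⊑)` into itself. -/
structure IsEmbedding (f : No.{u} → No.{u}) : Prop where
  le_iff : ∀ x y, f x ≤ f y ↔ x ≤ y
  simpler_iff : ∀ x y, (f x).Simpler (f y) ↔ x.Simpler y

/-- `IsParametrization S Ξ`: the class `S` is a surreal substructure, that is, the image of an
embedding of `(No, ≤, ⊑)` into itself, and `Ξ` is such an embedding with image `S`. (The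
embedding with image `S` is unique; it is the defining isomorphism `Ξ_S` of `S`.) -/
def IsParametrization (S : Set No.{u}) (Ξ : No.{u} → No.{u}) : Prop :=
  IsEmbedding Ξ ∧ Set.range Ξ = S

/-- The imbrication `S ≺ T = Ξ_S(T)` of `T` into the surreal substructure `S`. -/
def imbrication (S T : Set No.{u}) : Set No.{u} :=
  {y | ∃ Ξ, IsParametrization S Ξ ∧ y ∈ Ξ '' T}

/-- The transfinite self-imbrication `S^{≺ α}`: it is `No` for `α = 0`, it is
`S^{≺ β} ≺ S` for `α = β + 1`, and it is the intersection of all `S^{≺ β}`, `β < α`, for limit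
ordinals `α`. -/
noncomputable def selfImbrication (S : Set No.{u}) (α : Ordinal.{u}) : Set No.{u} :=
  Ordinal.limitRecOn (motive := fun _ => Set No.{u}) α
    Set.univ
    (fun _ T => imbrication T S)
    (fun α _ T => ⋂ β, ⋂ h : β < α, T β h)

/-- The class `a ×̇ No` of all concatenation products `a ×̇ x`. -/
def concatMultiples (a : No.{u}) : Set No.{u} :=
  Set.range (concatMul a)

/-- The class `ω ×̇ No` of purely infinite numbers. -/
noncomputable def purelyInfinite : Set No.{u} :=
  concatMultiples (ofOrdinal Ordinal.omega0)

/-- `No(γ)`: the numbers of length less than `γ`. -/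
def lengthBelow (γ : Ordinal.{u}) : Set No.{u} :=
  {x | x.length < γ}

/-- The translations `x ↦ x + c` with `c ∈ A`. -/
def translations (A : Set No.{u}) : Set (No.{u} → No.{u}) :=
  {g | ∃ c ∈ A, g = fun x => x + c}

/-- A function group acting on `No`: a set-sized group, under composition, of strictly increasing
bijections of `No`. -/
structure IsFunctionGroup (G : Set (No.{u} → No.{u})) : Prop where
  small : Small.{u} G
  strictMono : ∀ g ∈ G, StrictMono g
  bijective : ∀ g ∈ G, Function.Bijective g
  id_mem : id ∈ G
  comp_mem : ∀ g ∈ G, ∀ h ∈ G, g ∘ h ∈ G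
  inv_mem : ∀ g ∈ G, ∃ h ∈ G, h ∘ g = id ∧ g ∘ h = id

/-- The halo of `x` under `G`: the convex hull of the orbit of `x`. -/
def halo (G : Set (No.{u} → No.{u})) (x : No.{u}) : Set No.{u} :=
  {y | ∃ g ∈ G, ∃ h ∈ G, g x ≤ y ∧ y ≤ h x}

/-- The class of `G`-simple elements: the numbers that are the simplest element of their halo. -/
def simpleElements (G : Set (No.{u} → No.{u})) : Set No.{u} :=
  {x | IsRoot (halo G x) x}

end No

/-! Write κ = ω^α. The heart is `concatMul_add`: adding a number c of length below κ to κ ×̇ z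
appends the signs of c. Inductively, every option of κ ×̇ z is a translate of a simpler multiple κ
×̇ z' by plus or minus an ordinal below κ, so translating the options by c leaves them cofinal with
themselves. This needs the numbers of length below κ to be closed under addition: ℓ(x + y) is at
most the natural sum of the lengths, and powers of ω are closed under natural sums.

Hence the halo of κ ×̇ z lies between numbers extending κ ×̇ z. The extensions of a number form a
convex class, so κ ×̇ z is the root of its halo. Conversely, a number that is not a multiple of κ
changes sign inside a κ-block; truncating it at the start of that block gives a strictly simpler
number in its halo (`exists_simpler_concatMultiple`).

For the self-imbrications, uniqueness of parametrizations turns imbrication of multiples into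
ordinal multiplication. At limits one uses that the multiples of κ are the sequences constant on
κ-blocks (`mem_concatMultiples_iff`). -/

namespace No

/-! ### Initial segments, options and simplicity -/

theorem sign_eq_zero_iff (x : No.{u}) {β : Ordinal.{u}} : x.sign β = 0 ↔ x.length ≤ β := by
  rw [← not_iff_not, not_le, ← x.sign_ne_zero_iff]

theorem Simpler.refl (x : No.{u}) : x.Simpler x := fun _ _ => rfl

theorem Simpler.length_le {x y : No.{u}} (h : x.Simpler y) : x.length ≤ y.length := by
  by_contra! hl
  have h1 := h _ hl
  rw [y.sign_eq_zero_iff.2 le_rfl, sign_eq_zero_iff] at h1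
  exact h1.not_gt hl

theorem Simpler.trans {x y z : No.{u}} (h : x.Simpler y) (h' : y.Simpler z) : x.Simpler z :=
  fun β hβ => (h β hβ).trans (h' β (hβ.trans_le h.length_le))

theorem Simpler.antisymm {x y : No.{u}} (h : x.Simpler y) (h' : y.Simpler x) : x = y := by
  by_contra hne
  exact (Simpler.length_lt h hne).not_ge h'.length_le

/-- The initial segment of `x` of length `min β ℓ(x)`. -/
noncomputable def restrict (x : No.{u}) (β : Ordinal.{u}) : No.{u} where
  length := min β x.length
  sign γ := if γ < β then x.sign γ else 0
  sign_ne_zero_iff γ := by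
    by_cases h : γ < β <;> simp [h, x.sign_ne_zero_iff]

theorem restrict_sign_of_lt {x : No.{u}} {β γ : Ordinal.{u}} (h : γ < β) :
    (x.restrict β).sign γ = x.sign γ := if_pos h

theorem restrict_sign_of_le {x : No.{u}} {β γ : Ordinal.{u}} (h : β ≤ γ) :
    (x.restrict β).sign γ = 0 := if_neg h.not_gt

theorem restrict_simpler (x : No.{u}) (β : Ordinal.{u}) : (x.restrict β).Simpler x :=
  fun _ hγ => restrict_sign_of_lt (lt_min_iff.1 hγ).1

theorem restrict_length_of_le {x : No.{u}} {β : Ordinal.{u}} (h : β ≤ x.length) :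
    (x.restrict β).length = β := min_eq_left h

theorem restrict_of_length_le {x : No.{u}} {β : Ordinal.{u}} (h : x.length ≤ β) :
    x.restrict β = x := by
  refine sign_injective (funext fun γ => ?_)
  by_cases hγ : γ < β
  · exact restrict_sign_of_lt hγ
  · rw [restrict_sign_of_le (not_lt.1 hγ), x.sign_eq_zero_iff.2 (h.trans (not_lt.1 hγ))]

theorem restrict_congr {x y : No.{u}} {β : Ordinal.{u}} (h : ∀ γ < β, x.sign γ = y.sign γ) :
    x.restrict β = y.restrict β := by
  refine sign_injective (funext fun γ => ?_)
  by_cases hγ : γ < β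
  · rw [restrict_sign_of_lt hγ, restrict_sign_of_lt hγ, h γ hγ]
  · rw [restrict_sign_of_le (not_lt.1 hγ), restrict_sign_of_le (not_lt.1 hγ)]

theorem Simpler.restrict_eq {x y : No.{u}} (h : x.Simpler y) : y.restrict x.length = x := by
  rw [← restrict_congr h, restrict_of_length_le le_rfl]

theorem restrict_lt_of_sign_eq_one {x : No.{u}} {β : Ordinal.{u}} (h : x.sign β = 1) :
    x.restrict β < x :=
  lt_iff.2 ⟨β, fun _ hγ => restrict_sign_of_lt hγ, by
    rw [restrict_sign_of_le le_rfl, h]; decide⟩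

theorem lt_restrict_of_sign_eq_neg_one {x : No.{u}} {β : Ordinal.{u}} (h : x.sign β = -1) :
    x < x.restrict β :=
  lt_iff.2 ⟨β, fun _ hγ => (restrict_sign_of_lt hγ).symm, by
    rw [restrict_sign_of_le le_rfl, h]; decide⟩

theorem restrict_mem_leftOptions {x : No.{u}} {β : Ordinal.{u}} (h : x.sign β = 1) :
    x.restrict β ∈ leftOptions x := ⟨restrict_simpler x β, restrict_lt_of_sign_eq_one h⟩

theorem restrict_mem_rightOptions {x : No.{u}} {β : Ordinal.{u}} (h : x.sign β = -1) :
    x.restrict β ∈ rightOptions x := ⟨restrict_simpler x β, lt_restrict_of_sign_eq_neg_one h⟩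

theorem sign_eq_neg_one_of_lt {a b : SignType} (h : a < b) (hb : b ≠ 1) : a = -1 := by
  revert a b; decide

theorem mem_leftOptions_iff {x a : No.{u}} :
    a ∈ leftOptions x ↔ ∃ β, x.sign β = 1 ∧ a = x.restrict β := by
  refine ⟨fun ⟨h, hlt⟩ => ⟨a.length, ?_, h.restrict_eq.symm⟩, ?_⟩
  · have hx := (x.sign_ne_zero_iff _).2 (h.length_lt hlt.ne)
    by_contra h1
    have h2 : x.sign a.length = -1 := by
      generalize x.sign a.length = s at *; revert s; decide
    have := lt_restrict_of_sign_eq_neg_one h2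
    rw [h.restrict_eq] at this
    exact lt_asymm this hlt
  · rintro ⟨β, hβ, rfl⟩
    exact restrict_mem_leftOptions hβ

theorem mem_rightOptions_iff {x a : No.{u}} :
    a ∈ rightOptions x ↔ ∃ β, x.sign β = -1 ∧ a = x.restrict β := by
  refine ⟨fun ⟨h, hlt⟩ => ⟨a.length, ?_, h.restrict_eq.symm⟩, ?_⟩
  · have hx := (x.sign_ne_zero_iff _).2 (h.length_lt hlt.ne')
    by_contra h1
    have h2 : x.sign a.length = 1 := by
      generalize x.sign a.length = s at *; revert s; decide
    have := restrict_lt_of_sign_eq_one h2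
    rw [h.restrict_eq] at this
    exact lt_asymm this hlt
  · rintro ⟨β, hβ, rfl⟩
    exact restrict_mem_rightOptions hβ

/-- Two numbers `x < y` are comparable for simplicity, or separated by a simpler number. -/
theorem options_of_lt {x y : No.{u}} (h : x < y) :
    x ∈ leftOptions y ∨ y ∈ rightOptions x ∨ ∃ w, w ∈ rightOptions x ∧ w ∈ leftOptions y := by
  obtain ⟨α, hα, hlt⟩ := lt_iff.1 h
  have hr := restrict_congr hα
  by_cases hy : y.sign α = 1
  · by_cases hx : x.sign α = -1
    · exact .inr (.inr ⟨x.restrict α, restrict_mem_rightOptions hx,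
        hr ▸ restrict_mem_leftOptions hy⟩)
    · have hx0 : x.sign α = 0 := by
        generalize x.sign α = s at *; rw [hy] at hlt; revert s; decide
      left
      rw [sign_eq_zero_iff] at hx0
      rw [← restrict_of_length_le hx0, hr]
      exact restrict_mem_leftOptions hy
  · have hx := sign_eq_neg_one_of_lt hlt hy
    have hy0 : y.sign α = 0 := by
      generalize y.sign α = s at *; rw [hx] at hlt; revert s; decide
    right; left
    rw [sign_eq_zero_iff] at hy0
    rw [← restrict_of_length_le hy0, ← hr]
    exact restrict_mem_rightOptions hx

/-- By `options_of_lt`, if `x` were not simpler than `y`, some option of `x` would equal `y` or lie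
strictly between the two. -/
theorem simpler_of_forall_options {x y : No.{u}} (hl : ∀ l ∈ leftOptions x, l < y)
    (hr : ∀ r ∈ rightOptions x, y < r) : x.Simpler y := by
  rcases lt_trichotomy x y with h | rfl | h
  · obtain h | h | ⟨w, h, h'⟩ := options_of_lt h
    · exact h.1
    · exact absurd (hr y h) (lt_irrefl _)
    · exact absurd (hr w h) h'.2.not_gt
  · exact .refl _
  · obtain h | h | ⟨w, h, h'⟩ := options_of_lt h
    · exact absurd (hl y h) (lt_irrefl _)
    · exact h.1
    · exact absurd (hl w h') h.2.not_gt

theorem lt_of_simpler_of_mem_leftOptions {x y l : No.{u}} (h : x.Simpler y)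
    (hl : l ∈ leftOptions x) : l < y := by
  obtain ⟨β, hβ, rfl⟩ := mem_leftOptions_iff.1 hl
  have hx : β < x.length := (x.sign_ne_zero_iff β).1 (by rw [hβ]; decide)
  rw [restrict_congr fun γ hγ => h γ (hγ.trans hx)]
  exact restrict_lt_of_sign_eq_one ((h β hx).symm.trans hβ)

theorem lt_of_simpler_of_mem_rightOptions {x y r : No.{u}} (h : x.Simpler y)
    (hr : r ∈ rightOptions x) : y < r := by
  obtain ⟨β, hβ, rfl⟩ := mem_rightOptions_iff.1 hr
  have hx : β < x.length := (x.sign_ne_zero_iff β).1 (by rw [hβ]; decide)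
  rw [restrict_congr fun γ hγ => h γ (hγ.trans hx)]
  exact lt_restrict_of_sign_eq_neg_one ((h β hx).symm.trans hβ)

theorem isRoot_options (x : No.{u}) : IsRoot (cut (leftOptions x) (rightOptions x)) x :=
  ⟨⟨fun _ h => h.2, fun _ h => h.2⟩, fun _ h => simpler_of_forall_options h.1 h.2⟩

/-! ### Roots of cuts and separation in bounded length -/

/-- A nonempty cut has a root, namely its shortest element. -/
theorem exists_isRoot_cut {L R : Set No.{u}} (h : (cut L R).Nonempty) :
    ∃ x, IsRoot (cut L R) x := by
  obtain ⟨x, hx, hmin⟩ := (InvImage.wf No.length wellFounded_lt).has_min _ h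
  refine ⟨x, hx, fun y hy => simpler_of_forall_options (fun l hl => ?_) (fun r hr => ?_)⟩
  -- Otherwise the option `l` lies in the cut and is shorter than `x`.
  · by_contra! hyl
    exact hmin l ⟨fun a ha => (hy.1 a ha).trans_le hyl, fun b hb => hl.2.trans (hx.2 b hb)⟩
      (length_lt_of_mem_leftOptions hl)
  · by_contra! hyl
    exact hmin r ⟨fun a ha => (hx.1 a ha).trans hr.2, fun b hb => hyl.trans_lt (hy.2 b hb)⟩
      (length_lt_of_mem_rightOptions hr)

open Classical in
/-- The number of length `β` whose sign at `γ < β` is `1` if `P γ` holds, and `-1` otherwise. -/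
noncomputable def ofSigns (β : Ordinal.{u}) (P : Ordinal.{u} → Prop) : No.{u} where
  length := β
  sign γ := if γ < β then if P γ then 1 else -1 else 0
  sign_ne_zero_iff γ := by
    by_cases h : γ < β <;> by_cases h' : P γ <;> simp [h, h']

theorem ofSigns_sign_of_pos {β γ : Ordinal.{u}} {P : Ordinal.{u} → Prop} (h : γ < β) (hP : P γ) :
    (ofSigns β P).sign γ = 1 := by simp [ofSigns, h, hP]

theorem ofSigns_sign_of_neg {β γ : Ordinal.{u}} {P : Ordinal.{u} → Prop} (h : γ < β) (hP : ¬P γ) :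
    (ofSigns β P).sign γ = -1 := by simp [ofSigns, h, hP]

theorem ofSigns_restrict {β γ : Ordinal.{u}} {P : Ordinal.{u} → Prop} (h : γ ≤ β) :
    (ofSigns β P).restrict γ = ofSigns γ P := by
  refine sign_injective (funext fun δ => ?_)
  by_cases hδ : δ < γ
  · rw [restrict_sign_of_lt hδ]
    simp [ofSigns, hδ, hδ.trans_le h]
  · rw [restrict_sign_of_le (not_lt.1 hδ)]
    simp [ofSigns, hδ]

/-- The path through the tree of sign sequences that goes up exactly at the members of `A`. -/
def pathUp (A : Set No.{u}) (β : Ordinal.{u}) : Prop :=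
  -- The bound `γ < β` only serves the recursion, since `ofSigns β` reads its predicate below `β`
  -- alone.
  ofSigns β (fun γ => ∃ _ : γ < β, pathUp A γ) ∈ A
termination_by β

theorem pathUp_iff (A : Set No.{u}) (β : Ordinal.{u}) :
    pathUp A β ↔ ofSigns β (pathUp A) ∈ A := by
  rw [pathUp]
  refine iff_of_eq (congrArg (· ∈ A) (sign_injective (funext fun δ => ?_)))
  by_cases hδ : δ < β
  · by_cases h : pathUp A δ
    · rw [ofSigns_sign_of_pos hδ h, ofSigns_sign_of_pos hδ ⟨hδ, h⟩]
    · rw [ofSigns_sign_of_neg hδ h, ofSigns_sign_of_neg hδ fun ⟨_, h'⟩ => h h']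
  · simp [ofSigns, hδ]

/-- Numbers of length less than `β` can be separated by a number of length at most `β`. -/
theorem exists_mem_cut_length_le {L R : Set No.{u}} {β : Ordinal.{u}}
    (hLR : ∀ l ∈ L, ∀ r ∈ R, l < r) (hL : ∀ l ∈ L, l.length < β) (hR : ∀ r ∈ R, r.length < β) :
    ∃ x ∈ cut L R, x.length ≤ β := by
  by_contra! hcut
  -- `A` is the lower closure of `L`. If the cut has no member of length at most `β`, each `p γ`
  -- with `γ ≤ β` is below some `l` or above some `r`, according to the direction in which the path
  -- turns.
  let A : Set No.{u} := {x | ∃ l ∈ L, x ≤ l}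
  let p (γ : Ordinal.{u}) : No.{u} := ofSigns γ (pathUp A)
  have hlow {γ} (h : pathUp A γ) : ∃ l ∈ L, p γ ≤ l := (pathUp_iff A γ).1 h
  have hhigh {γ} (hγ : γ ≤ β) (h : ¬pathUp A γ) : ∃ r ∈ R, r ≤ p γ := by
    have h1 : ∀ l ∈ L, l < p γ := by
      intro l hl
      by_contra! hl'
      exact h ((pathUp_iff A γ).2 ⟨l, hl, hl'⟩)
    by_contra! h2
    exact (hcut (p γ) ⟨h1, h2⟩).not_ge hγ
  have hne {x : No.{u}} (hx : x.length < β) : p β ≠ x := fun h => by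
    rw [← h] at hx; exact lt_irrefl _ hx
  by_cases hβ : pathUp A β
  · obtain ⟨l, hl, hle⟩ := hlow hβ
    -- Here `p β < l`, and `l` is too short to extend `p β`. So some right option `p γ` of `p β` is
    -- at most `l`; the path turned down there, so some `r` is at most `p γ`, against `L < R`.
    obtain h | h | ⟨w, h, h'⟩ := options_of_lt (hle.lt_of_ne (hne (hL l hl)))
    · exact (length_lt_of_mem_leftOptions h).not_gt (hL l hl)
    all_goals
      obtain ⟨γ, hγ, hw⟩ := mem_rightOptions_iff.1 h
      have hγβ : γ < β := ((p β).sign_ne_zero_iff γ).1 (by rw [hγ]; decide)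
      have hγ' : ¬pathUp A γ := fun h' => by
        rw [ofSigns_sign_of_pos hγβ h'] at hγ; exact absurd hγ (by decide)
      obtain ⟨r, hr, hrp⟩ := hhigh hγβ.le hγ'
      rw [ofSigns_restrict hγβ.le] at hw
    · exact (hLR l hl r hr).not_ge (hrp.trans_eq hw.symm)
    · exact (hLR l hl r hr).not_gt ((hrp.trans_eq hw.symm).trans_lt h'.2)
  · obtain ⟨r, hr, hle⟩ := hhigh le_rfl hβ
    obtain h | h | ⟨w, h', h⟩ := options_of_lt (hle.lt_of_ne (hne (hR r hr)).symm)
    rotate_left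
    · exact (length_lt_of_mem_rightOptions h).not_gt (hR r hr)
    all_goals
      obtain ⟨γ, hγ, hw⟩ := mem_leftOptions_iff.1 h
      have hγβ : γ < β := ((p β).sign_ne_zero_iff γ).1 (by rw [hγ]; decide)
      have hγ' : pathUp A γ := by
        by_contra h'
        rw [ofSigns_sign_of_neg hγβ h'] at hγ; exact absurd hγ (by decide)
      obtain ⟨l, hl, hrp⟩ := hlow hγ'
      rw [ofSigns_restrict hγβ.le] at hw
    · exact (hLR l hl r hr).not_gt (h'.2.trans_le (hw.trans_le hrp))
    · exact (hLR l hl r hr).not_ge (hw.trans_le hrp)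

theorem isRoot_bracket {L R : Set No.{u}} (h : (cut L R).Nonempty) :
    IsRoot (cut L R) (bracket L R) := by
  have h' := exists_isRoot_cut h
  rw [bracket, dif_pos h']
  exact h'.choose_spec

theorem bracket_eq {L R : Set No.{u}} {x : No.{u}} (h : IsRoot (cut L R) x) :
    bracket L R = x := (isRoot_bracket ⟨x, h.1⟩).unique h

/-! ### Natural sums and powers of ω -/

/-- The natural sum of two ordinals: the least strictly increasing function of two variables. -/
noncomputable def natSum (a b : Ordinal.{u}) : Ordinal.{u} :=
  max (⨆ a' : Set.Iio a, Order.succ (natSum a' b)) (⨆ b' : Set.Iio b, Order.succ (natSum a b'))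
termination_by (a, b)
decreasing_by
  · exact Prod.Lex.left _ _ a'.2
  · exact Prod.Lex.right _ b'.2

theorem natSum_lt_left {a a' : Ordinal.{u}} (h : a' < a) (b : Ordinal.{u}) :
    natSum a' b < natSum a b := by
  conv_rhs => rw [natSum]
  exact lt_max_of_lt_left (Order.succ_le_iff.1
    (Ordinal.le_iSup (fun a' : Set.Iio a => Order.succ (natSum a' b)) ⟨a', h⟩))

theorem natSum_lt_right (a : Ordinal.{u}) {b b' : Ordinal.{u}} (h : b' < b) :
    natSum a b' < natSum a b := by
  conv_rhs => rw [natSum]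
  exact lt_max_of_lt_right (Order.succ_le_iff.1
    (Ordinal.le_iSup (fun b' : Set.Iio b => Order.succ (natSum a b')) ⟨b', h⟩))

theorem natSum_le {a b c : Ordinal.{u}} (h : ∀ a' < a, natSum a' b < c)
    (h' : ∀ b' < b, natSum a b' < c) : natSum a b ≤ c := by
  rw [natSum]
  exact max_le (Ordinal.iSup_le fun a' => Order.succ_le_of_lt (h _ a'.2))
    (Ordinal.iSup_le fun b' => Order.succ_le_of_lt (h' _ b'.2))

/-- The right-hand side is strictly increasing in each of `κ * n + a` and `κ * m + b`: lowering a
quotient loses a whole `κ`, more than the remainders can restore. The natural sum is the least such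
function. -/
theorem natSum_mul_add_le {κ : Ordinal.{u}} (hκ : ∀ a < κ, ∀ b < κ, natSum a b < κ)
    (n m : ℕ) {a b : Ordinal.{u}} (ha : a < κ) (hb : b < κ) :
    natSum (κ * n + a) (κ * m + b) ≤ κ * (n + m : ℕ) + natSum a b := by
  have hκ0 : κ ≠ 0 := (pos_of_gt ha).ne'
  have split {x : Ordinal.{u}} {k : ℕ} {d : Ordinal.{u}} (hx : x < κ * k + d) (hd : d < κ) :
      ∃ k' : ℕ, ∃ d' < κ, x = κ * k' + d' ∧ (k' < k ∨ k' = k ∧ d' < d) := by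
    have hxk : x < κ * (k + 1 : ℕ) := by
      rw [Nat.cast_succ, mul_add, mul_one]; exact hx.trans (by gcongr)
    obtain ⟨k', hk'⟩ := Ordinal.lt_omega0.1
      (((Ordinal.lt_mul_iff_div_lt hκ0).1 hxk).trans (Ordinal.natCast_lt_omega0 _))
    have hlt := (Ordinal.lt_mul_iff_div_lt hκ0).1 hxk
    rw [hk', Nat.cast_lt] at hlt
    have hxeq := Ordinal.div_add_mod x κ
    rw [hk'] at hxeq
    refine ⟨k', x % κ, Ordinal.mod_lt x hκ0, hxeq.symm, ?_⟩
    rcases (Nat.lt_succ_iff.1 hlt).lt_or_eq with h | rfl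
    · exact .inl h
    · rw [← hxeq] at hx
      exact .inr ⟨rfl, by simpa using hx⟩
  have jump {k k' : ℕ} (hk : k' < k) {c : Ordinal.{u}} (hc : c < κ) : κ * k' + c < κ * k := by
    calc κ * k' + c < κ * k' + κ := by gcongr
      _ = κ * (k' + 1 : ℕ) := by rw [Nat.cast_succ, mul_add, mul_one]
      _ ≤ κ * k := by gcongr; exact_mod_cast hk
  generalize hx : κ * n + a = x
  generalize hy : κ * m + b = y
  induction x using WellFoundedLT.induction generalizing n a y m b with | _ x ihx
  induction y using WellFoundedLT.induction generalizing m b with | _ y ihy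
  refine natSum_le (fun x' hx' => ?_) (fun y' hy' => ?_)
  · obtain ⟨k, d, hd, he, hlt⟩ := split (hx ▸ hx') ha
    refine (ihx x' hx' k m hd hb he.symm y hy).trans_lt ?_
    rcases hlt with hlt | ⟨rfl, hlt⟩
    · exact (jump (by omega) (hκ _ hd _ hb)).trans_le le_self_add
    · gcongr; exact natSum_lt_left hlt b
  · obtain ⟨k, d, hd, he, hlt⟩ := split (hy ▸ hy') hb
    refine (ihy y' hy' k hd he.symm).trans_lt ?_
    rcases hlt with hlt | ⟨rfl, hlt⟩
    · exact (jump (by omega) (hκ _ ha _ hd)).trans_le le_self_add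
    · gcongr; exact natSum_lt_right a hlt

/-- The powers of `ω` are closed under the natural sum. -/
theorem natSum_lt_omega0_opow (α : Ordinal.{u}) :
    ∀ a < Ordinal.omega0 ^ α, ∀ b < Ordinal.omega0 ^ α, natSum a b < Ordinal.omega0 ^ α := by
  induction α using Ordinal.limitRecOn with
  | zero =>
    simp only [Ordinal.opow_zero, Order.lt_one_iff]
    rintro a rfl b rfl
    exact nonpos_iff_eq_zero.1 (natSum_le (by simp) (by simp))
  | add_one β ih =>
    have hκ0 : Ordinal.omega0 ^ β ≠ 0 := Ordinal.opow_ne_zero _ Ordinal.omega0_ne_zero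
    intro a ha b hb
    rw [Ordinal.opow_add_one] at *
    obtain ⟨n, hn⟩ := Ordinal.lt_omega0.1 ((Ordinal.lt_mul_iff_div_lt hκ0).1 ha)
    obtain ⟨m, hm⟩ := Ordinal.lt_omega0.1 ((Ordinal.lt_mul_iff_div_lt hκ0).1 hb)
    have h := natSum_mul_add_le ih n m (Ordinal.mod_lt a hκ0) (Ordinal.mod_lt b hκ0)
    rw [← hn, ← hm, Ordinal.div_add_mod, Ordinal.div_add_mod] at h
    refine h.trans_lt ?_
    calc _ < Ordinal.omega0 ^ β * (n + m : ℕ) + Ordinal.omega0 ^ β := by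
          gcongr; exact ih _ (Ordinal.mod_lt a hκ0) _ (Ordinal.mod_lt b hκ0)
      _ = Ordinal.omega0 ^ β * (n + m + 1 : ℕ) := by
          rw [Nat.cast_succ (n + m), mul_add, mul_one]
      _ ≤ _ := by gcongr; exact (Ordinal.natCast_lt_omega0 _).le
  | limit α hα ih =>
    intro a ha b hb
    obtain ⟨β, hβ, ha⟩ := (Ordinal.lt_opow_of_isSuccLimit Ordinal.omega0_ne_zero hα).1 ha
    obtain ⟨γ, hγ, hb⟩ := (Ordinal.lt_opow_of_isSuccLimit Ordinal.omega0_ne_zero hα).1 hb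
    have hmono {δ ε : Ordinal.{u}} (h : δ ≤ ε) : Ordinal.omega0 ^ δ ≤ Ordinal.omega0 ^ ε :=
      Ordinal.opow_le_opow_right Ordinal.omega0_pos h
    exact (ih (max β γ) (max_lt hβ hγ) a (ha.trans_le (hmono (le_max_left _ _))) b
      (hb.trans_le (hmono (le_max_right _ _)))).trans_le (hmono (max_lt hβ hγ).le)

/-! ### Conway addition makes the numbers an ordered abelian group -/

/-- The left options of the sum `x + y`. -/
def addLeft (x y : No.{u}) : Set No.{u} := (· + y) '' leftOptions x ∪ (x + ·) '' leftOptions y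

/-- The right options of the sum `x + y`. -/
def addRight (x y : No.{u}) : Set No.{u} := (· + y) '' rightOptions x ∪ (x + ·) '' rightOptions y

theorem forall_mem_addLeft {x y : No.{u}} {P : No.{u} → Prop} :
    (∀ z ∈ addLeft x y, P z) ↔
      (∀ a ∈ leftOptions x, P (a + y)) ∧ ∀ b ∈ leftOptions y, P (x + b) := by
  simp only [addLeft, Set.mem_union, or_imp, forall_and, Set.forall_mem_image]

theorem forall_mem_addRight {x y : No.{u}} {P : No.{u} → Prop} :
    (∀ z ∈ addRight x y, P z) ↔
      (∀ a ∈ rightOptions x, P (a + y)) ∧ ∀ b ∈ rightOptions y, P (x + b) := by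
  simp only [addRight, Set.mem_union, or_imp, forall_and, Set.forall_mem_image]

theorem add_eq_bracket (x y : No.{u}) : x + y = bracket (addLeft x y) (addRight x y) := add_eq x y

/-- Only the two sums concerned must lie in their defining cuts, so this is available inside the
induction showing that all sums do. -/
theorem add_lt_add_left_of_mem_cut {x y z : No.{u}}
    (hy : x + y ∈ cut (addLeft x y) (addRight x y)) (hz : x + z ∈ cut (addLeft x z) (addRight x z))
    (h : y < z) : x + y < x + z := by
  obtain h | h | ⟨w, h, h'⟩ := options_of_lt h
  · exact (forall_mem_addLeft.1 hz.1).2 _ h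
  · exact (forall_mem_addRight.1 hy.2).2 _ h
  · exact ((forall_mem_addRight.1 hy.2).2 _ h).trans ((forall_mem_addLeft.1 hz.1).2 _ h')

theorem add_lt_add_right_of_mem_cut {x y z : No.{u}}
    (hy : y + x ∈ cut (addLeft y x) (addRight y x)) (hz : z + x ∈ cut (addLeft z x) (addRight z x))
    (h : y < z) : y + x < z + x := by
  obtain h | h | ⟨w, h, h'⟩ := options_of_lt h
  · exact (forall_mem_addLeft.1 hz.1).1 _ h
  · exact (forall_mem_addRight.1 hy.2).1 _ h
  · exact ((forall_mem_addRight.1 hy.2).1 _ h).trans ((forall_mem_addLeft.1 hz.1).1 _ h')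

/-- The two claims need each other: the length bounds on sums of options let
`exists_mem_cut_length_le` produce a member of the cut of length at most the natural sum, and the
root is no longer than that member. -/
theorem isRoot_add_and_length_add_le (x y : No.{u}) :
    IsRoot (cut (addLeft x y) (addRight x y)) (x + y) ∧
      (x + y).length ≤ natSum x.length y.length := by
  generalize hm : x.length = m
  generalize hn : y.length = n
  induction m using WellFoundedLT.induction generalizing x y n with | _ m ihm
  induction n using WellFoundedLT.induction generalizing y with | _ n ihn
  have hx {a : No.{u}} (ha : a.length < x.length) (b : No.{u}) := ihm _ (hm ▸ ha) a b rfl _ rfl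
  have hy {b : No.{u}} (hb : b.length < y.length) := ihn _ (hn ▸ hb) b rfl
  subst hm hn
  have ll {x a : No.{u}} (h : a ∈ leftOptions x) := length_lt_of_mem_leftOptions h
  have lr {x a : No.{u}} (h : a ∈ rightOptions x) := length_lt_of_mem_rightOptions h
  have hLR : ∀ l ∈ addLeft x y, ∀ r ∈ addRight x y, l < r := by
    rw [forall_mem_addLeft]
    simp only [forall_mem_addRight]
    refine ⟨fun a ha => ⟨fun a' ha' => ?_, fun b hb => ?_⟩,
      fun b hb => ⟨fun a ha => ?_, fun b' hb' => ?_⟩⟩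
    · exact add_lt_add_right_of_mem_cut (hx (ll ha) y).1.1 (hx (lr ha') y).1.1 (ha.2.trans ha'.2)
    · exact (add_lt_add_left_of_mem_cut (hx (ll ha) y).1.1 (hx (ll ha) b).1.1 hb.2).trans
        ((forall_mem_addLeft.1 (hy (lr hb)).1.1.1).1 a ha)
    · exact ((forall_mem_addRight.1 (hy (ll hb)).1.1.2).1 a ha).trans
        (add_lt_add_left_of_mem_cut (hx (lr ha) b).1.1 (hx (lr ha) y).1.1 hb.2)
    · exact add_lt_add_left_of_mem_cut (hy (ll hb)).1.1 (hy (lr hb')).1.1 (hb.2.trans hb'.2)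
  have hxl {a : No.{u}} (ha : a.length < x.length) :
      (a + y).length < natSum x.length y.length := (hx ha y).2.trans_lt (natSum_lt_left ha _)
  have hyl {b : No.{u}} (hb : b.length < y.length) :
      (x + b).length < natSum x.length y.length := (hy hb).2.trans_lt (natSum_lt_right _ hb)
  obtain ⟨z, hz, hzl⟩ := exists_mem_cut_length_le hLR
    (forall_mem_addLeft.2 ⟨fun a ha => hxl (ll ha), fun b hb => hyl (ll hb)⟩)
    (forall_mem_addRight.2 ⟨fun a ha => hxl (lr ha), fun b hb => hyl (lr hb)⟩)
  have hroot : IsRoot (cut (addLeft x y) (addRight x y)) (x + y) := by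
    rw [add_eq_bracket]
    exact isRoot_bracket ⟨z, hz⟩
  exact ⟨hroot, (hroot.2 z hz).length_le.trans hzl⟩

theorem isRoot_add (x y : No.{u}) : IsRoot (cut (addLeft x y) (addRight x y)) (x + y) :=
  (isRoot_add_and_length_add_le x y).1

theorem length_add_le (x y : No.{u}) : (x + y).length ≤ natSum x.length y.length :=
  (isRoot_add_and_length_add_le x y).2

theorem add_lt_add_left' (x : No.{u}) {y z : No.{u}} (h : y < z) : x + y < x + z :=
  add_lt_add_left_of_mem_cut (isRoot_add x y).1 (isRoot_add x z).1 h

theorem add_lt_add_right' {y z : No.{u}} (h : y < z) (x : No.{u}) : y + x < z + x :=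
  add_lt_add_right_of_mem_cut (isRoot_add y x).1 (isRoot_add z x).1 h

theorem add_comm' (x y : No.{u}) : x + y = y + x := by
  generalize hm : x.length = m
  generalize hn : y.length = n
  induction m using WellFoundedLT.induction generalizing x y n with | _ m ihm
  induction n using WellFoundedLT.induction generalizing y with | _ n ihn
  subst hm hn
  have hx {a : No.{u}} (ha : a.length < x.length) := ihm _ ha a y rfl _ rfl
  have hy {b : No.{u}} (hb : b.length < y.length) := ihn _ hb b rfl
  rw [add_eq_bracket, add_eq_bracket y x, addLeft, addRight, addLeft, addRight]
  congr 1
  all_goals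
    rw [Set.union_comm]
    congr 1 <;> refine Set.image_congr fun a ha => ?_
  · exact hy (length_lt_of_mem_leftOptions ha)
  · exact hx (length_lt_of_mem_leftOptions ha)
  · exact hy (length_lt_of_mem_rightOptions ha)
  · exact hx (length_lt_of_mem_rightOptions ha)

noncomputable instance : Zero No.{u} := ⟨ofOrdinal 0⟩

theorem length_zero : (0 : No.{u}).length = 0 := rfl

theorem zero_simpler (x : No.{u}) : (0 : No.{u}).Simpler x :=
  fun _ hβ => absurd (length_zero ▸ hβ) not_lt_zero

theorem leftOptions_zero : leftOptions (0 : No.{u}) = ∅ :=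
  Set.eq_empty_of_forall_notMem fun _ h => not_lt_zero (length_lt_of_mem_leftOptions h)

theorem rightOptions_zero : rightOptions (0 : No.{u}) = ∅ :=
  Set.eq_empty_of_forall_notMem fun _ h => not_lt_zero (length_lt_of_mem_rightOptions h)

theorem add_zero' (x : No.{u}) : x + 0 = x := by
  generalize hm : x.length = m
  induction m using WellFoundedLT.induction generalizing x with | _ m ihm
  subst hm
  rw [add_eq_bracket]
  refine bracket_eq ?_
  convert isRoot_options x using 2
  · rw [addLeft, leftOptions_zero, Set.image_empty, Set.union_empty]
    exact (Set.image_congr fun a ha => ihm _ (length_lt_of_mem_leftOptions ha) a rfl).trans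
      (Set.image_id' _)
  · rw [addRight, rightOptions_zero, Set.image_empty, Set.union_empty]
    exact (Set.image_congr fun a ha => ihm _ (length_lt_of_mem_rightOptions ha) a rfl).trans
      (Set.image_id' _)

/-- Otherwise `a` would lie in the cut while being shorter than its root. Thus any cut
representation is cofinal in the canonical one. -/
theorem IsRoot.exists_le_of_mem_leftOptions {L R : Set No.{u}} {x a : No.{u}}
    (hx : IsRoot (cut L R) x) (ha : a ∈ leftOptions x) : ∃ l ∈ L, a ≤ l := by
  by_contra! h
  exact (length_lt_of_mem_leftOptions ha).not_ge
    (hx.2 a ⟨h, fun r hr => ha.2.trans (hx.1.2 r hr)⟩).length_le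

theorem IsRoot.exists_le_of_mem_rightOptions {L R : Set No.{u}} {x a : No.{u}}
    (hx : IsRoot (cut L R) x) (ha : a ∈ rightOptions x) : ∃ r ∈ R, r ≤ a := by
  by_contra! h
  exact (length_lt_of_mem_rightOptions ha).not_ge
    (hx.2 a ⟨fun l hl => (hx.1.1 l hl).trans ha.2, h⟩).length_le

/-- The sum can be computed from arbitrary cut representations of its terms. -/
theorem isRoot_add_of_isRoot {L R L' R' : Set No.{u}} {x y : No.{u}} (hx : IsRoot (cut L R) x)
    (hy : IsRoot (cut L' R') y) :
    IsRoot (cut ((· + y) '' L ∪ (x + ·) '' L') ((· + y) '' R ∪ (x + ·) '' R')) (x + y) := by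
  have hr {a b : No.{u}} (h : a ≤ b) (c : No.{u}) : a + c ≤ b + c :=
    (StrictMono.monotone fun _ _ h => add_lt_add_right' h c) h
  have hl {a b : No.{u}} (h : a ≤ b) (c : No.{u}) : c + a ≤ c + b :=
    (StrictMono.monotone fun _ _ h => add_lt_add_left' c h) h
  refine ⟨⟨?_, ?_⟩, fun z hz => (isRoot_add x y).2 z ⟨?_, ?_⟩⟩
  · simp only [Set.mem_union, or_imp, forall_and, Set.forall_mem_image]
    exact ⟨fun a ha => add_lt_add_right' (hx.1.1 a ha) y,
      fun a ha => add_lt_add_left' x (hy.1.1 a ha)⟩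
  · simp only [Set.mem_union, or_imp, forall_and, Set.forall_mem_image]
    exact ⟨fun a ha => add_lt_add_right' (hx.1.2 a ha) y,
      fun a ha => add_lt_add_left' x (hy.1.2 a ha)⟩
  · refine forall_mem_addLeft.2 ⟨fun a ha => ?_, fun b hb => ?_⟩
    · obtain ⟨l, hlL, hle⟩ := hx.exists_le_of_mem_leftOptions ha
      exact (hr hle y).trans_lt (hz.1 _ (.inl ⟨l, hlL, rfl⟩))
    · obtain ⟨l, hlL, hle⟩ := hy.exists_le_of_mem_leftOptions hb
      exact (hl hle x).trans_lt (hz.1 _ (.inr ⟨l, hlL, rfl⟩))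
  · refine forall_mem_addRight.2 ⟨fun a ha => ?_, fun b hb => ?_⟩
    · obtain ⟨l, hlL, hle⟩ := hx.exists_le_of_mem_rightOptions ha
      exact (hz.2 _ (.inl ⟨l, hlL, rfl⟩)).trans_le (hr hle y)
    · obtain ⟨l, hlL, hle⟩ := hy.exists_le_of_mem_rightOptions hb
      exact (hz.2 _ (.inr ⟨l, hlL, rfl⟩)).trans_le (hl hle x)

/-- `isRoot_add_of_isRoot` allows the defining cut of an inner sum in place of its canonical
options. By induction both sides are then roots of the same cut. -/
theorem add_assoc' (x y z : No.{u}) : x + y + z = x + (y + z) := by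
  generalize hm : x.length = m
  generalize hn : y.length = n
  generalize hk : z.length = k
  induction m using WellFoundedLT.induction generalizing x y z n k with | _ m ihm
  induction n using WellFoundedLT.induction generalizing y z k with | _ n ihn
  induction k using WellFoundedLT.induction generalizing z with | _ k ihk
  subst hm hn hk
  have hx {a : No.{u}} (ha : a.length < x.length) := ihm _ ha a y z rfl _ rfl _ rfl
  have hy {b : No.{u}} (hb : b.length < y.length) := ihn _ hb b z rfl _ rfl
  have hz {c : No.{u}} (hc : c.length < z.length) := ihk _ hc c rfl
  refine (isRoot_add_of_isRoot (isRoot_add x y) (isRoot_options z)).unique ?_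
  convert isRoot_add_of_isRoot (isRoot_options x) (isRoot_add y z) using 2
  · simp only [addLeft, Set.image_union, Set.image_image, Set.union_assoc]
    refine congrArg₂ _ ?_ (congrArg₂ _ ?_ ?_) <;> refine Set.image_congr fun a ha => ?_
    · exact hx (length_lt_of_mem_leftOptions ha)
    · exact hy (length_lt_of_mem_leftOptions ha)
    · exact hz (length_lt_of_mem_leftOptions ha)
  · simp only [addRight, Set.image_union, Set.image_image, Set.union_assoc]
    refine congrArg₂ _ ?_ (congrArg₂ _ ?_ ?_) <;> refine Set.image_congr fun a ha => ?_
    · exact hx (length_lt_of_mem_rightOptions ha)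
    · exact hy (length_lt_of_mem_rightOptions ha)
    · exact hz (length_lt_of_mem_rightOptions ha)

noncomputable instance : Neg No.{u} where
  neg x :=
    { length := x.length
      sign := fun β => -x.sign β
      sign_ne_zero_iff := fun β => by
        rw [← x.sign_ne_zero_iff]; generalize x.sign β = s; revert s; decide }

theorem sign_neg (x : No.{u}) (β : Ordinal.{u}) : (-x).sign β = -x.sign β := rfl

theorem neg_neg' (x : No.{u}) : - -x = x :=
  sign_injective (funext fun β => by simp only [sign_neg, neg_neg])

theorem neg_lt_neg' {x y : No.{u}} (h : x < y) : -y < -x := by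
  obtain ⟨α, hα, h⟩ := lt_iff.1 h
  refine lt_iff.2 ⟨α, fun β hβ => by rw [sign_neg, sign_neg, hα β hβ], ?_⟩
  rw [sign_neg, sign_neg]
  generalize x.sign α = s at *
  generalize y.sign α = t at *
  revert s t; decide

theorem Simpler.neg {x y : No.{u}} (h : x.Simpler y) : (-x).Simpler (-y) :=
  fun β hβ => by rw [sign_neg, sign_neg, h β hβ]

theorem neg_mem_leftOptions {x a : No.{u}} (h : a ∈ rightOptions x) : -a ∈ leftOptions (-x) :=
  ⟨h.1.neg, neg_lt_neg' h.2⟩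

theorem neg_mem_rightOptions {x a : No.{u}} (h : a ∈ leftOptions x) : -a ∈ rightOptions (-x) :=
  ⟨h.1.neg, neg_lt_neg' h.2⟩

/-- As `0` is simpler than everything, it only has to lie in the cut; for instance `a + -x < a + -a
= 0` for a left option `a`. -/
theorem add_neg_cancel' (x : No.{u}) : x + -x = 0 := by
  generalize hm : x.length = m
  induction m using WellFoundedLT.induction generalizing x with | _ m ihm
  subst hm
  rw [add_eq_bracket]
  refine bracket_eq ⟨⟨forall_mem_addLeft.2 ⟨fun a ha => ?_, fun b hb => ?_⟩,
    forall_mem_addRight.2 ⟨fun a ha => ?_, fun b hb => ?_⟩⟩, fun y _ => zero_simpler y⟩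
  · rw [← ihm _ (length_lt_of_mem_leftOptions ha) a rfl]
    exact add_lt_add_left' a (neg_lt_neg' ha.2)
  · have hb' := neg_mem_rightOptions hb
    rw [neg_neg'] at hb'
    rw [← ihm _ (length_lt_of_mem_rightOptions hb') _ rfl, neg_neg']
    exact add_lt_add_right' hb'.2 b
  · rw [← ihm _ (length_lt_of_mem_rightOptions ha) a rfl]
    exact add_lt_add_left' a (neg_lt_neg' ha.2)
  · have hb' := neg_mem_leftOptions hb
    rw [neg_neg'] at hb'
    rw [← ihm _ (length_lt_of_mem_leftOptions hb') _ rfl, neg_neg']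
    exact add_lt_add_right' hb'.2 b

noncomputable instance : AddCommGroup No.{u} where
  add_assoc := add_assoc'
  zero_add x := (add_comm' 0 x).trans (add_zero' x)
  add_zero := add_zero'
  nsmul := nsmulRec
  zsmul := zsmulRec
  neg_add_cancel x := (add_comm' (-x) x).trans (add_neg_cancel' x)
  add_comm := add_comm'

instance : IsOrderedAddMonoid No.{u} where
  add_le_add_left _ _ h c := (StrictMono.monotone fun _ _ h => add_lt_add_right' h c) h

/-! ### Concatenation -/

/-- The concatenation of two sign sequences. -/
noncomputable def concat (x y : No.{u}) : No.{u} where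
  length := x.length + y.length
  sign γ := if γ < x.length then x.sign γ else y.sign (γ - x.length)
  sign_ne_zero_iff γ := by
    by_cases h : γ < x.length
    · simp [h, x.sign_ne_zero_iff, h.trans_le le_self_add]
    · rw [if_neg h, y.sign_ne_zero_iff, Ordinal.sub_lt_of_le (not_lt.1 h)]

theorem concat_sign_of_lt {x y : No.{u}} {γ : Ordinal.{u}} (h : γ < x.length) :
    (concat x y).sign γ = x.sign γ := if_pos h

theorem concat_sign_add (x y : No.{u}) (γ : Ordinal.{u}) :
    (concat x y).sign (x.length + γ) = y.sign γ := by
  simp [concat]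

theorem simpler_concat (x y : No.{u}) : x.Simpler (concat x y) :=
  fun _ h => (concat_sign_of_lt h).symm

theorem concat_restrict_of_le {x y : No.{u}} {β : Ordinal.{u}} (h : β ≤ x.length) :
    (concat x y).restrict β = x.restrict β :=
  restrict_congr fun _ hγ => concat_sign_of_lt (hγ.trans_le h)

theorem concat_restrict_add (x y : No.{u}) (β : Ordinal.{u}) :
    (concat x y).restrict (x.length + β) = concat x (y.restrict β) := by
  refine sign_injective (funext fun γ => ?_)
  rcases lt_or_ge γ x.length with h | h
  · rw [restrict_sign_of_lt (h.trans_le le_self_add), concat_sign_of_lt h, concat_sign_of_lt h]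
  · obtain ⟨γ, rfl⟩ := exists_add_of_le h
    rw [concat_sign_add]
    by_cases hγ : γ < β
    · rw [restrict_sign_of_lt (by gcongr), restrict_sign_of_lt hγ, concat_sign_add]
    · rw [restrict_sign_of_le (by gcongr; exact not_lt.1 hγ), restrict_sign_of_le (not_lt.1 hγ)]

theorem concat_lt_concat (x : No.{u}) {y z : No.{u}} (h : y < z) : concat x y < concat x z := by
  obtain ⟨α, hα, h⟩ := lt_iff.1 h
  refine lt_iff.2 ⟨x.length + α, fun β hβ => ?_, by rwa [concat_sign_add, concat_sign_add]⟩
  rcases lt_or_ge β x.length with h' | h'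
  · rw [concat_sign_of_lt h', concat_sign_of_lt h']
  · obtain ⟨γ, rfl⟩ := exists_add_of_le h'
    rw [concat_sign_add, concat_sign_add, hα γ (lt_of_add_lt_add_left hβ)]

theorem concat_le_concat (x : No.{u}) {y z : No.{u}} (h : y ≤ z) : concat x y ≤ concat x z :=
  (StrictMono.monotone fun _ _ h => concat_lt_concat x h) h

theorem Simpler.exists_eq_concat {x y : No.{u}} (h : x.Simpler y) : ∃ z, y = concat x z := by
  refine ⟨⟨y.length - x.length, fun γ => y.sign (x.length + γ), fun γ => ?_⟩,
    sign_injective (funext fun γ => ?_)⟩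
  · rw [y.sign_ne_zero_iff, Ordinal.lt_sub]
  · rcases lt_or_ge γ x.length with h' | h'
    · rw [concat_sign_of_lt h', h γ h']
    · obtain ⟨γ, rfl⟩ := exists_add_of_le h'
      rw [concat_sign_add]

theorem neg_concat (x y : No.{u}) : -concat x y = concat (-x) (-y) := by
  refine sign_injective (funext fun γ => ?_)
  rw [sign_neg]
  rcases lt_or_ge γ x.length with h' | h'
  · rw [concat_sign_of_lt h', concat_sign_of_lt (by exact h'), sign_neg]
  · obtain ⟨γ, rfl⟩ := exists_add_of_le h'
    rw [concat_sign_add]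
    exact (concat_sign_add (-x) (-y) γ).symm

theorem mem_leftOptions_concat {x y a : No.{u}} (h : a ∈ leftOptions (concat x y)) :
    a ∈ leftOptions x ∨ ∃ b ∈ leftOptions y, a = concat x b := by
  obtain ⟨β, hβ, rfl⟩ := mem_leftOptions_iff.1 h
  rcases lt_or_ge β x.length with h' | h'
  · rw [concat_sign_of_lt h'] at hβ
    rw [concat_restrict_of_le h'.le]
    exact .inl (restrict_mem_leftOptions hβ)
  · obtain ⟨γ, rfl⟩ := exists_add_of_le h'
    rw [concat_sign_add] at hβ
    exact .inr ⟨_, restrict_mem_leftOptions hβ, concat_restrict_add x y γ⟩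

theorem mem_rightOptions_concat {x y a : No.{u}} (h : a ∈ rightOptions (concat x y)) :
    a ∈ rightOptions x ∨ ∃ b ∈ rightOptions y, a = concat x b := by
  have := neg_mem_leftOptions h
  rw [neg_concat] at this
  obtain h | ⟨b, hb, h⟩ := mem_leftOptions_concat this
  · left
    simpa using neg_mem_rightOptions h
  · refine .inr ⟨-b, by simpa using neg_mem_rightOptions hb, ?_⟩
    rw [← neg_neg a, h, neg_concat, neg_neg]

theorem ofOrdinal_sign_of_lt {α β : Ordinal.{u}} (h : β < α) : (ofOrdinal α).sign β = 1 :=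
  if_pos h

theorem ofOrdinal_sign_of_le {α β : Ordinal.{u}} (h : α ≤ β) : (ofOrdinal α).sign β = 0 :=
  if_neg h.not_gt

theorem le_ofOrdinal_length (x : No.{u}) : x ≤ ofOrdinal x.length := by
  by_contra! h
  obtain ⟨α, -, h⟩ := lt_iff.1 h
  rcases lt_or_ge α x.length with h' | h'
  · rw [ofOrdinal_sign_of_lt h'] at h
    generalize x.sign α = s at h; revert s; decide
  · rw [ofOrdinal_sign_of_le h', x.sign_eq_zero_iff.2 h'] at h
    exact lt_irrefl _ h

/-! ### Concatenation multiples of an ordinal -/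

section concatMul

variable {κ : Ordinal.{u}}

theorem concatMul_ofOrdinal_sign (hκ : κ ≠ 0) (z : No.{u}) (γ : Ordinal.{u}) :
    (concatMul (ofOrdinal κ) z).sign γ = z.sign (γ / κ) := by
  change z.sign (γ / κ) * (ofOrdinal κ).sign (γ % κ) = _
  rw [ofOrdinal_sign_of_lt (Ordinal.mod_lt γ hκ), mul_one]

theorem concatMul_ofOrdinal_sign_mul (hκ : κ ≠ 0) (z : No.{u}) (γ : Ordinal.{u}) :
    (concatMul (ofOrdinal κ) z).sign (κ * γ) = z.sign γ := by
  rw [concatMul_ofOrdinal_sign hκ, Ordinal.mul_div_cancel γ hκ]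

theorem length_concatMul_ofOrdinal (κ : Ordinal.{u}) (z : No.{u}) :
    (concatMul (ofOrdinal κ) z).length = κ * z.length := rfl

theorem concatMul_strictMono (hκ : κ ≠ 0) : StrictMono (concatMul (ofOrdinal κ)) := by
  intro x y h
  obtain ⟨α, hα, h⟩ := lt_iff.1 h
  refine lt_iff.2 ⟨κ * α, fun β hβ => ?_, ?_⟩
  · rw [concatMul_ofOrdinal_sign hκ, concatMul_ofOrdinal_sign hκ,
      hα _ ((Ordinal.lt_mul_iff_div_lt hκ).1 hβ)]
  · rwa [concatMul_ofOrdinal_sign_mul hκ, concatMul_ofOrdinal_sign_mul hκ]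

theorem concatMul_isEmbedding (hκ : κ ≠ 0) : IsEmbedding (concatMul (ofOrdinal κ)) where
  le_iff _ _ := (concatMul_strictMono hκ).le_iff_le
  simpler_iff x y := by
    refine ⟨fun h β hβ => ?_, fun h β hβ => ?_⟩
    · have := h (κ * β) (by rw [length_concatMul_ofOrdinal]; gcongr)
      rwa [concatMul_ofOrdinal_sign_mul hκ, concatMul_ofOrdinal_sign_mul hκ] at this
    · rw [concatMul_ofOrdinal_sign hκ, concatMul_ofOrdinal_sign hκ,
        h _ ((Ordinal.lt_mul_iff_div_lt hκ).1 hβ)]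

theorem neg_concatMul (hκ : κ ≠ 0) (z : No.{u}) :
    -concatMul (ofOrdinal κ) z = concatMul (ofOrdinal κ) (-z) :=
  sign_injective (funext fun γ => by
    rw [sign_neg, concatMul_ofOrdinal_sign hκ, concatMul_ofOrdinal_sign hκ, sign_neg])

theorem concatMul_restrict (hκ : κ ≠ 0) (z : No.{u}) (γ : Ordinal.{u}) :
    (concatMul (ofOrdinal κ) z).restrict (κ * γ) = concatMul (ofOrdinal κ) (z.restrict γ) := by
  refine sign_injective (funext fun β => ?_)
  rw [concatMul_ofOrdinal_sign hκ]
  by_cases h : β < κ * γ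
  · rw [restrict_sign_of_lt h, restrict_sign_of_lt ((Ordinal.lt_mul_iff_div_lt hκ).1 h),
      concatMul_ofOrdinal_sign hκ]
  · rw [restrict_sign_of_le (not_lt.1 h),
      restrict_sign_of_le (not_lt.1 fun h' => h ((Ordinal.lt_mul_iff_div_lt hκ).2 h'))]

/-- If `x` has a block of `δ` pluses after the initial segment of length `β`, then the initial
segment of length `β + δ` is the concatenation with the ordinal `δ`. -/
theorem restrict_add_of_forall_sign_eq_one {x : No.{u}} {β δ : Ordinal.{u}} (hβ : β ≤ x.length)
    (h : ∀ ε < δ, x.sign (β + ε) = 1) : x.restrict (β + δ) = concat (x.restrict β) (ofOrdinal δ) := by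
  have hl := restrict_length_of_le hβ
  refine sign_injective (funext fun γ => ?_)
  rcases lt_or_ge γ β with h' | h'
  · rw [restrict_sign_of_lt (h'.trans_le le_self_add), concat_sign_of_lt (by rwa [hl]),
      restrict_sign_of_lt h']
  · obtain ⟨γ, rfl⟩ := exists_add_of_le h'
    have : (concat (x.restrict β) (ofOrdinal δ)).sign (β + γ) = _ :=
      hl ▸ concat_sign_add (x.restrict β) (ofOrdinal δ) γ
    rw [this]
    rcases lt_or_ge γ δ with hγ | hγ
    · rw [restrict_sign_of_lt (by gcongr), h γ hγ, ofOrdinal_sign_of_lt hγ]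
    · rw [restrict_sign_of_le (by gcongr), ofOrdinal_sign_of_le hγ]

theorem concatMul_restrict_add (hκ : κ ≠ 0) {z : No.{u}} {γ δ : Ordinal.{u}} (hγ : z.sign γ = 1)
    (hδ : δ ≤ κ) : (concatMul (ofOrdinal κ) z).restrict (κ * γ + δ) =
      concat (concatMul (ofOrdinal κ) (z.restrict γ)) (ofOrdinal δ) := by
  rw [restrict_add_of_forall_sign_eq_one, concatMul_restrict hκ]
  · rw [length_concatMul_ofOrdinal]
    gcongr
    exact ((z.sign_ne_zero_iff γ).1 (by rw [hγ]; decide)).le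
  · intro ε hε
    rw [concatMul_ofOrdinal_sign hκ, Ordinal.mul_add_div _ hκ,
      Ordinal.div_eq_zero_of_lt (hε.trans_le hδ), add_zero, hγ]

/-- Each plus of `z` becomes a block of `κ` pluses, and a left option stops `δ` steps into such a
block. -/
theorem mem_leftOptions_concatMul_iff (hκ : κ ≠ 0) {z a : No.{u}} :
    a ∈ leftOptions (concatMul (ofOrdinal κ) z) ↔ ∃ γ, z.sign γ = 1 ∧ ∃ δ < κ,
      a = concat (concatMul (ofOrdinal κ) (z.restrict γ)) (ofOrdinal δ) := by
  rw [mem_leftOptions_iff]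
  constructor
  · rintro ⟨β, hβ, rfl⟩
    rw [concatMul_ofOrdinal_sign hκ] at hβ
    refine ⟨β / κ, hβ, β % κ, Ordinal.mod_lt β hκ, ?_⟩
    rw [← concatMul_restrict_add hκ hβ (Ordinal.mod_lt β hκ).le, Ordinal.div_add_mod]
  · rintro ⟨γ, hγ, δ, hδ, rfl⟩
    refine ⟨κ * γ + δ, ?_, (concatMul_restrict_add hκ hγ hδ.le).symm⟩
    rw [concatMul_ofOrdinal_sign hκ, Ordinal.mul_add_div _ hκ, Ordinal.div_eq_zero_of_lt hδ,
      add_zero, hγ]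

end concatMul

/-! ### Adding a short number to a multiple of ω^α -/

section Sum

variable {α : Ordinal.{u}}

theorem add_mem_lengthBelow {x y : No.{u}} (hx : x ∈ lengthBelow (Ordinal.omega0 ^ α))
    (hy : y ∈ lengthBelow (Ordinal.omega0 ^ α)) : x + y ∈ lengthBelow (Ordinal.omega0 ^ α) :=
  (length_add_le x y).trans_lt (natSum_lt_omega0_opow α _ hx _ hy)

theorem neg_mem_lengthBelow {x : No.{u}} {γ : Ordinal.{u}} (hx : x ∈ lengthBelow γ) :
    -x ∈ lengthBelow γ := hx

/-- The numbers `z` for which adding `c` of length less than `ω ^ α` to a multiple `ω ^ α ×̇ z'` of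
a number `z'` strictly simpler than `z` amounts to concatenating `c`. -/
def AddEqConcatBelow (α : Ordinal.{u}) (z : No.{u}) : Prop :=
  ∀ z' : No.{u}, z'.Simpler z → z' ≠ z → ∀ c ∈ lengthBelow (Ordinal.omega0 ^ α),
    concatMul (ofOrdinal (Ordinal.omega0 ^ α)) z' + c =
      concat (concatMul (ofOrdinal (Ordinal.omega0 ^ α)) z') c

theorem AddEqConcatBelow.neg {z : No.{u}} (h : AddEqConcatBelow α z) : AddEqConcatBelow α (-z) := by
  have hκ : Ordinal.omega0 ^ α ≠ 0 := Ordinal.opow_ne_zero _ Ordinal.omega0_ne_zero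
  intro z' hz' hne c hc
  have := h (-z') (by simpa using hz'.neg) (fun h => hne (by rw [← h, neg_neg])) (-c) hc
  rw [← neg_concatMul hκ, ← neg_concat, ← neg_add] at this
  exact neg_injective this

/-- With `l = κ ×̇ z' + δ`, one has `l + c = κ ×̇ z' + (δ + c)`. Replacing `δ + c` by the ordinal
that is its length, still below `κ`, gives a larger left option. -/
theorem AddEqConcatBelow.add_lt {z : No.{u}} (h : AddEqConcatBelow α z) {l c y : No.{u}}
    (hl : l ∈ leftOptions (concatMul (ofOrdinal (Ordinal.omega0 ^ α)) z))
    (hc : c ∈ lengthBelow (Ordinal.omega0 ^ α))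
    (hy : (concatMul (ofOrdinal (Ordinal.omega0 ^ α)) z).Simpler y) : l + c < y := by
  have hκ : Ordinal.omega0 ^ α ≠ 0 := Ordinal.opow_ne_zero _ Ordinal.omega0_ne_zero
  obtain ⟨γ, hγ, δ, hδ, rfl⟩ := (mem_leftOptions_concatMul_iff hκ).1 hl
  have hr := restrict_mem_leftOptions hγ
  rw [← h _ hr.1 hr.2.ne (ofOrdinal δ) hδ, add_assoc,
    h _ hr.1 hr.2.ne _ (add_mem_lengthBelow (show (ofOrdinal δ).length < _ from hδ) hc)]
  refine (concat_le_concat _ (le_ofOrdinal_length _)).trans_lt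
    (lt_of_simpler_of_mem_leftOptions hy ((mem_leftOptions_concatMul_iff hκ).2
      ⟨γ, hγ, _, add_mem_lengthBelow (show (ofOrdinal δ).length < _ from hδ) hc, rfl⟩))

/-- The same argument with `δ - c`: together with `add_lt`, translation by `c` keeps the left
options cofinal. -/
theorem AddEqConcatBelow.exists_le_add {z : No.{u}} (h : AddEqConcatBelow α z) {l c : No.{u}}
    (hl : l ∈ leftOptions (concatMul (ofOrdinal (Ordinal.omega0 ^ α)) z))
    (hc : c ∈ lengthBelow (Ordinal.omega0 ^ α)) :
    ∃ l' ∈ leftOptions (concatMul (ofOrdinal (Ordinal.omega0 ^ α)) z), l ≤ l' + c := by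
  have hκ : Ordinal.omega0 ^ α ≠ 0 := Ordinal.opow_ne_zero _ Ordinal.omega0_ne_zero
  obtain ⟨γ, hγ, δ, hδ, rfl⟩ := (mem_leftOptions_concatMul_iff hκ).1 hl
  have hr := restrict_mem_leftOptions hγ
  have hd : ofOrdinal δ + -c ∈ lengthBelow (Ordinal.omega0 ^ α) :=
    add_mem_lengthBelow (show (ofOrdinal δ).length < _ from hδ) (neg_mem_lengthBelow hc)
  refine ⟨_, (mem_leftOptions_concatMul_iff hκ).2 ⟨γ, hγ, _, hd, rfl⟩, ?_⟩
  rw [← h _ hr.1 hr.2.ne (ofOrdinal δ) hδ, ← h _ hr.1 hr.2.ne (ofOrdinal _) hd, add_assoc]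
  refine add_le_add_right ?_ _
  rw [← sub_le_iff_le_add, sub_eq_add_neg]
  exact le_ofOrdinal_length _

/-- The cut defining `x + c` has the options of `x` translated by `c`, cofinal with those of `x`,
and the sums `x + b`, which are concatenations by induction. So it has the same root as the cut of
`concat x c`. Right options follow by negation. -/
theorem concatMul_add (z : No.{u}) {c : No.{u}} (hc : c ∈ lengthBelow (Ordinal.omega0 ^ α)) :
    concatMul (ofOrdinal (Ordinal.omega0 ^ α)) z + c =
      concat (concatMul (ofOrdinal (Ordinal.omega0 ^ α)) z) c := by
  have hκ : Ordinal.omega0 ^ α ≠ 0 := Ordinal.opow_ne_zero _ Ordinal.omega0_ne_zero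
  generalize hm : z.length = m
  generalize hn : c.length = n
  -- All short `c` are treated at once, since the options of `z` bring in the translations `δ + c`
  -- and `δ - c`.
  induction m using WellFoundedLT.induction generalizing z c n with | _ m ihm
  induction n using WellFoundedLT.induction generalizing c with | _ n ihn
  subst hm hn
  have hz : AddEqConcatBelow α z := fun z' hz' hne c hc => ihm _ (hz'.length_lt hne) z' hc rfl _ rfl
  have hcl {b : No.{u}} (hb : b.length < c.length) := ihn _ hb (hb.trans hc) rfl
  set x := concatMul (ofOrdinal (Ordinal.omega0 ^ α)) z with hx
  have hneg : -x = concatMul (ofOrdinal (Ordinal.omega0 ^ α)) (-z) := neg_concatMul hκ z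
  refine (isRoot_add x c).unique ⟨⟨?_, ?_⟩, fun y hy => ?_⟩
  · refine forall_mem_addLeft.2 ⟨fun l hl => hz.add_lt hl hc (simpler_concat x c), fun b hb => ?_⟩
    rw [hcl (length_lt_of_mem_leftOptions hb)]
    exact concat_lt_concat x hb.2
  · refine forall_mem_addRight.2 ⟨fun l hl => ?_, fun b hb => ?_⟩
    · have := hz.neg.add_lt (hneg ▸ neg_mem_leftOptions hl) (neg_mem_lengthBelow hc)
        (hneg ▸ (simpler_concat x c).neg)
      rw [← neg_add] at this
      exact neg_lt_neg_iff.1 this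
    · rw [hcl (length_lt_of_mem_rightOptions hb)]
      exact concat_lt_concat x hb.2
  · have hyl := forall_mem_addLeft.1 hy.1
    have hyr := forall_mem_addRight.1 hy.2
    refine simpler_of_forall_options (fun l hl => ?_) (fun r hr => ?_)
    · obtain hl | ⟨b, hb, rfl⟩ := mem_leftOptions_concat hl
      · obtain ⟨l', hl', hle⟩ := hz.exists_le_add hl hc
        exact hle.trans_lt (hyl.1 l' hl')
      · rw [← hcl (length_lt_of_mem_leftOptions hb)]
        exact hyl.2 b hb
    · obtain hr | ⟨b, hb, rfl⟩ := mem_rightOptions_concat hr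
      · obtain ⟨l', hl', hle⟩ :=
          hz.neg.exists_le_add (hneg ▸ neg_mem_leftOptions hr) (neg_mem_lengthBelow hc)
        rw [← hneg] at hl'
        have hl'' := neg_mem_rightOptions hl'
        rw [neg_neg] at hl''
        refine (hyr.1 _ hl'').trans_le ?_
        rw [← neg_le_neg_iff, neg_add, neg_neg]
        exact hle
      · rw [← hcl (length_lt_of_mem_rightOptions hb)]
        exact hyr.2 b hb

end Sum

/-! ### Translation groups, halos and simple numbers -/

theorem small_lengthBelow (γ : Ordinal.{u}) : Small.{u} (lengthBelow γ) := by
  refine small_of_injective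
    (f := fun (x : lengthBelow γ) (β : Set.Iio γ) => x.1.sign β) fun x y h => ?_
  refine Subtype.ext (sign_injective (funext fun β => ?_))
  rcases lt_or_ge β γ with hβ | hβ
  · exact congrFun h ⟨β, hβ⟩
  · rw [x.1.sign_eq_zero_iff.2 (x.2.le.trans hβ), y.1.sign_eq_zero_iff.2 (y.2.le.trans hβ)]

theorem isFunctionGroup_translations {A : Set No.{u}} [Small.{u} A] (h0 : 0 ∈ A)
    (hadd : ∀ x ∈ A, ∀ y ∈ A, x + y ∈ A) (hneg : ∀ x ∈ A, -x ∈ A) :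
    IsFunctionGroup (translations A) where
  small := by
    have : translations A = (fun c x => x + c) '' A := by
      ext g; simp only [translations, Set.mem_image, Set.mem_ofPred_eq, eq_comm]
    rw [this]
    infer_instance
  strictMono := by
    rintro _ ⟨c, -, rfl⟩ x y h
    exact add_lt_add_left h c
  bijective := by
    rintro _ ⟨c, -, rfl⟩
    exact (Equiv.addRight c).bijective
  id_mem := ⟨0, h0, funext fun x => (add_zero x).symm⟩
  comp_mem := by
    rintro _ ⟨c, hc, rfl⟩ _ ⟨d, hd, rfl⟩
    exact ⟨d + c, hadd d hd c hc, funext fun x => add_assoc x d c⟩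
  inv_mem := by
    rintro _ ⟨c, hc, rfl⟩
    exact ⟨_, ⟨-c, hneg c hc, rfl⟩, funext fun x => add_neg_cancel_right x c,
      funext fun x => neg_add_cancel_right x c⟩

theorem zero_mem_lengthBelow_opow (α : Ordinal.{u}) : 0 ∈ lengthBelow (Ordinal.omega0 ^ α) :=
  Ordinal.opow_pos α Ordinal.omega0_pos

theorem isFunctionGroup_translations_lengthBelow (α : Ordinal.{u}) :
    IsFunctionGroup (translations (lengthBelow (Ordinal.omega0 ^ α))) :=
  have := small_lengthBelow (Ordinal.omega0 ^ α)
  isFunctionGroup_translations (zero_mem_lengthBelow_opow α)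
    (fun _ hx _ hy => add_mem_lengthBelow hx hy) (fun _ hx => neg_mem_lengthBelow hx)

theorem mem_halo_translations {A : Set No.{u}} {x y : No.{u}} :
    y ∈ halo (translations A) x ↔ ∃ c ∈ A, ∃ d ∈ A, x + c ≤ y ∧ y ≤ x + d := by
  constructor
  · rintro ⟨_, ⟨c, hc, rfl⟩, _, ⟨d, hd, rfl⟩, h⟩
    exact ⟨c, hc, d, hd, h⟩
  · rintro ⟨c, hc, d, hd, h⟩
    exact ⟨_, ⟨c, hc, rfl⟩, _, ⟨d, hd, rfl⟩, h⟩

/-- The class of numbers having a given initial segment is convex. -/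
theorem Simpler.of_le_of_le {x a b y : No.{u}} (ha : x.Simpler a) (hb : x.Simpler b) (h : a ≤ y)
    (h' : y ≤ b) : x.Simpler y :=
  simpler_of_forall_options (fun _ hl => (lt_of_simpler_of_mem_leftOptions ha hl).trans_le h)
    fun _ hr => h'.trans_lt (lt_of_simpler_of_mem_rightOptions hb hr)

theorem mem_concatMultiples_iff {κ : Ordinal.{u}} (hκ : κ ≠ 0) {x : No.{u}} :
    x ∈ concatMultiples (ofOrdinal κ) ↔ ∀ γ, ∀ δ < κ, x.sign (κ * γ + δ) = x.sign (κ * γ) := by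
  constructor
  · rintro ⟨z, rfl⟩ γ δ hδ
    rw [concatMul_ofOrdinal_sign hκ, concatMul_ofOrdinal_sign_mul hκ, Ordinal.mul_add_div _ hκ,
      Ordinal.div_eq_zero_of_lt hδ, add_zero]
  · intro h
    have hne : {γ | x.length ≤ κ * γ}.Nonempty :=
      ⟨x.length, Ordinal.le_mul_right _ (pos_iff_ne_zero.2 hκ)⟩
    refine ⟨⟨sInf {γ | x.length ≤ κ * γ}, fun γ => x.sign (κ * γ), fun γ => ?_⟩,
      sign_injective (funext fun γ => ?_)⟩
    · rw [x.sign_ne_zero_iff]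
      constructor
      · intro hγ
        by_contra! hle
        exact ((csInf_mem hne).trans (mul_le_mul_right hle κ)).not_gt hγ
      · intro hγ
        exact not_le.1 fun h' => notMem_of_lt_csInf' hγ h'
    · rw [concatMul_ofOrdinal_sign hκ]
      conv_rhs => rw [← Ordinal.div_add_mod γ κ]
      exact (h _ _ (Ordinal.mod_lt γ hκ)).symm

theorem nonneg_and_le_ofOrdinal {x : No.{u}} {δ : Ordinal.{u}} (h0 : x.sign 0 = 1)
    (h : ∀ ε < δ, x.sign ε = 1) (hδ : x.sign δ ≠ 1) : 0 ≤ x ∧ x ≤ ofOrdinal δ := by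
  have e0 : x.restrict 0 = 0 := sign_injective (funext fun γ =>
    (restrict_sign_of_le zero_le).trans (ofOrdinal_sign_of_le zero_le).symm)
  have e1 : x.restrict δ = ofOrdinal δ := sign_injective (funext fun γ => by
    rcases lt_or_ge γ δ with hγ | hγ
    · rw [restrict_sign_of_lt hγ, h γ hγ, ofOrdinal_sign_of_lt hγ]
    · rw [restrict_sign_of_le hγ, ofOrdinal_sign_of_le hγ])
  refine ⟨e0 ▸ (restrict_lt_of_sign_eq_one h0).le, ?_⟩
  rw [← e1]
  by_cases hx : x.sign δ = 0
  · rw [restrict_of_length_le (x.sign_eq_zero_iff.1 hx)]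
  · refine (lt_restrict_of_sign_eq_neg_one ?_).le
    generalize x.sign δ = s at *; revert s; decide

/-- A number which is not a multiple of `κ` lies within an ordinal less than `κ` of a strictly
simpler multiple of `κ`, measured by concatenation. -/
theorem exists_simpler_concatMultiple {κ : Ordinal.{u}} (hκ : κ ≠ 0) {x : No.{u}}
    (hx : x ∉ concatMultiples (ofOrdinal κ)) : ∃ w ∈ concatMultiples (ofOrdinal κ),
      w.Simpler x ∧ w ≠ x ∧ ∃ δ < κ, concat w (-ofOrdinal δ) ≤ x ∧ x ≤ concat w (ofOrdinal δ) := by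
  rw [mem_concatMultiples_iff hκ] at hx
  push Not at hx
  -- `γ` indexes the first non-constant block and `δ` is the first place where it breaks; the
  -- multiple sought is `x` truncated at `κ * γ`.
  obtain ⟨γ, hγ, hmin⟩ := wellFounded_lt.has_min {γ | ∃ δ < κ, x.sign (κ * γ + δ) ≠ x.sign (κ * γ)} hx
  obtain ⟨δ, ⟨hδ, hne⟩, hminδ⟩ :=
    wellFounded_lt.has_min {δ | δ < κ ∧ x.sign (κ * γ + δ) ≠ x.sign (κ * γ)} hγ
  have hlen : κ * γ < x.length := by
    by_contra! hle
    exact hne (by rw [x.sign_eq_zero_iff.2 hle, x.sign_eq_zero_iff.2 (hle.trans le_self_add)])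
  have hl := restrict_length_of_le hlen.le
  refine ⟨x.restrict (κ * γ), (mem_concatMultiples_iff hκ).2 fun ε ζ hζ => ?_, restrict_simpler _ _,
    fun h => by rw [h] at hl; exact hlen.ne' hl, δ, hδ, ?_⟩
  · rcases lt_or_ge ε γ with hε | hε
    · have h1 : κ * ε + ζ < κ * γ := calc
        κ * ε + ζ < κ * ε + κ := by gcongr
        _ = κ * (ε + 1) := by rw [mul_add, mul_one]
        _ ≤ κ * γ := by gcongr; exact Order.add_one_le_of_lt hε
      rw [restrict_sign_of_lt h1, restrict_sign_of_lt (le_self_add.trans_lt h1)]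
      by_contra hne
      exact hmin ε ⟨ζ, hζ, hne⟩ hε
    · have h1 : κ * γ ≤ κ * ε := by gcongr
      rw [restrict_sign_of_le h1, restrict_sign_of_le (h1.trans le_self_add)]
  · obtain ⟨e, he⟩ := (restrict_simpler x (κ * γ)).exists_eq_concat
    have hsign (ε : Ordinal.{u}) : x.sign (κ * γ + ε) = e.sign ε := by
      conv_lhs => rw [he]
      rw [← concat_sign_add (x.restrict (κ * γ)) e, hl]
    have hsign0 := hsign 0
    rw [add_zero] at hsign0
    rw [hsign, hsign0] at hne
    have hlt (ε) (hε : ε < δ) : e.sign ε = e.sign 0 := by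
      by_contra h
      exact hminδ ε ⟨hε.trans hδ, by rwa [hsign, hsign0]⟩ hε
    -- The tail `e` has exactly `δ` equal nonzero signs before its first change, so it lies between
    -- `-δ` and `δ`.
    suffices h : -ofOrdinal δ ≤ e ∧ e ≤ ofOrdinal δ by
      exact ⟨(concat_le_concat _ h.1).trans_eq he.symm, he.trans_le (concat_le_concat _ h.2)⟩
    have h0 : e.sign 0 ≠ 0 := by
      rw [← hsign0, x.sign_ne_zero_iff]; exact hlen
    by_cases h1 : e.sign 0 = 1
    · rw [h1] at hlt hne
      have h := nonneg_and_le_ofOrdinal h1 hlt hne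
      exact ⟨(neg_nonpos.2 (h.1.trans h.2)).trans h.1, h.2⟩
    · have h1 : e.sign 0 = -1 := by
        generalize e.sign 0 = s at h0 h1; revert s; decide
      rw [h1] at hlt hne
      have h := nonneg_and_le_ofOrdinal (x := -e) (δ := δ) (by rw [sign_neg, h1]; rfl)
        (fun ε hε => by rw [sign_neg, hlt ε hε]; rfl)
        (by rw [sign_neg]; intro h; exact hne (by rw [← neg_neg (e.sign δ), h]))
      exact ⟨neg_le.1 h.2, (neg_nonneg.1 h.1).trans (h.1.trans h.2)⟩

theorem concatMultiples_eq_simpleElements (α : Ordinal.{u}) :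
    concatMultiples (ofOrdinal (Ordinal.omega0 ^ α)) =
      simpleElements (translations (lengthBelow (Ordinal.omega0 ^ α))) := by
  have hκ : Ordinal.omega0 ^ α ≠ 0 := Ordinal.opow_ne_zero _ Ordinal.omega0_ne_zero
  ext x
  constructor
  · rintro ⟨z, rfl⟩
    refine ⟨mem_halo_translations.2 ⟨0, zero_mem_lengthBelow_opow α, 0, zero_mem_lengthBelow_opow α,
      by simp⟩, fun y hy => ?_⟩
    obtain ⟨c, hc, d, hd, h, h'⟩ := mem_halo_translations.1 hy
    rw [concatMul_add z hc] at h
    rw [concatMul_add z hd] at h'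
    exact (simpler_concat _ c).of_le_of_le (simpler_concat _ d) h h'
  · intro hx
    by_contra hx'
    obtain ⟨_, ⟨z, rfl⟩, hs, hne, δ, hδ, h, h'⟩ := exists_simpler_concatMultiple hκ hx'
    have hd : ofOrdinal δ ∈ lengthBelow (Ordinal.omega0 ^ α) := hδ
    rw [← concatMul_add z (neg_mem_lengthBelow hd)] at h
    rw [← concatMul_add z hd] at h'
    -- Being near is symmetric: from `w - δ ≤ x ≤ w + δ` the multiple `w` lies in the halo of `x`,
    -- whose root is `x`.
    refine hne (hs.antisymm (hx.2 _ (mem_halo_translations.2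
      ⟨_, neg_mem_lengthBelow hd, _, hd, ?_, ?_⟩)))
    · rwa [← sub_eq_add_neg, sub_le_iff_le_add]
    · rwa [← sub_le_iff_le_add, sub_eq_add_neg]

/-! ### Imbrications -/

/-- An embedding is determined by its image. -/
theorem IsParametrization.unique {S : Set No.{u}} {f g : No.{u} → No.{u}}
    (hf : IsParametrization S f) (hg : IsParametrization S g) : f = g := by
  suffices h : ∀ x, f x = g x from funext h
  intro x
  have hlt {f : No.{u} → No.{u}} (hf : IsEmbedding f) {x y} : f x < f y ↔ x < y := by
    rw [← not_le, hf.le_iff, not_le]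
  generalize hm : x.length = m
  induction m using WellFoundedLT.induction generalizing x with | _ m ih
  subst hm
  -- Write `g x = f y`. As `f` and `g` agree on the options of `x`, these options enclose `y`, so
  -- `x` is simpler than `y`.
  have key {f g : No.{u} → No.{u}} (hf : IsParametrization S f) (hg : IsParametrization S g)
      (h : ∀ y : No.{u}, y.length < x.length → f y = g y) : (f x).Simpler (g x) := by
    obtain ⟨y, hy⟩ : g x ∈ Set.range f := by rw [hf.2, ← hg.2]; exact ⟨x, rfl⟩
    rw [← hy, hf.1.simpler_iff]
    refine simpler_of_forall_options (fun l hl => ?_) (fun r hr => ?_)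
    · rw [← hlt hf.1, hy, h l (length_lt_of_mem_leftOptions hl), hlt hg.1]
      exact hl.2
    · rw [← hlt hf.1, hy, h r (length_lt_of_mem_rightOptions hr), hlt hg.1]
      exact hr.2
  exact (key hf hg fun y hy => ih _ hy y rfl).antisymm
    (key hg hf fun y hy => (ih _ hy y rfl).symm)

theorem ordinal_div_div {κ μ : Ordinal.{u}} (hκ : κ ≠ 0) (hμ : μ ≠ 0) (γ : Ordinal.{u}) :
    γ / κ / μ = γ / (κ * μ) :=
  eq_of_forall_gt_iff fun c => by
    rw [← Ordinal.lt_mul_iff_div_lt hμ, ← Ordinal.lt_mul_iff_div_lt hκ,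
      ← Ordinal.lt_mul_iff_div_lt (mul_ne_zero hκ hμ), mul_assoc]

theorem concatMul_concatMul {κ μ : Ordinal.{u}} (hκ : κ ≠ 0) (hμ : μ ≠ 0) (x : No.{u}) :
    concatMul (ofOrdinal κ) (concatMul (ofOrdinal μ) x) = concatMul (ofOrdinal (κ * μ)) x :=
  sign_injective (funext fun γ => by
    rw [concatMul_ofOrdinal_sign hκ, concatMul_ofOrdinal_sign hμ,
      concatMul_ofOrdinal_sign (mul_ne_zero hκ hμ), ordinal_div_div hκ hμ])

theorem imbrication_concatMultiples {κ μ : Ordinal.{u}} (hκ : κ ≠ 0) (hμ : μ ≠ 0) :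
    imbrication (concatMultiples (ofOrdinal κ)) (concatMultiples (ofOrdinal μ)) =
      concatMultiples (ofOrdinal (κ * μ)) := by
  have hp : IsParametrization (concatMultiples (ofOrdinal κ)) (concatMul (ofOrdinal κ)) :=
    ⟨concatMul_isEmbedding hκ, rfl⟩
  ext y
  constructor
  · rintro ⟨Ξ, hΞ, _, ⟨x, rfl⟩, rfl⟩
    rw [hΞ.unique hp, concatMul_concatMul hκ hμ]
    exact ⟨x, rfl⟩
  · rintro ⟨x, rfl⟩
    exact ⟨_, hp, _, ⟨x, rfl⟩, concatMul_concatMul hκ hμ x⟩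

theorem selfImbrication_purelyInfinite (α : Ordinal.{u}) :
    selfImbrication purelyInfinite α = concatMultiples (ofOrdinal (Ordinal.omega0 ^ α)) := by
  have hω (α : Ordinal.{u}) : Ordinal.omega0 ^ α ≠ 0 := Ordinal.opow_ne_zero _ Ordinal.omega0_ne_zero
  induction α using Ordinal.limitRecOn with
  | zero =>
    rw [selfImbrication, Ordinal.limitRecOn_zero, Ordinal.opow_zero]
    symm
    rw [Set.eq_univ_iff_forall]
    intro x
    rw [mem_concatMultiples_iff one_ne_zero]
    intro γ δ hδ
    rw [Order.lt_one_iff.1 hδ, add_zero]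
  | add_one β ih =>
    rw [selfImbrication, Ordinal.limitRecOn_add_one, Ordinal.opow_add_one,
      ← imbrication_concatMultiples (hω β) Ordinal.omega0_ne_zero, ← ih]
    rfl
  | limit α hα ih =>
    rw [selfImbrication, Ordinal.limitRecOn_limit _ _ _ _ hα]
    change (⋂ β, ⋂ (_ : β < α), selfImbrication purelyInfinite β) = _
    ext x
    rw [Set.mem_iInter₂, mem_concatMultiples_iff (hω α)]
    constructor
    · intro h γ δ hδ
      obtain ⟨β, hβ, hδ⟩ := (Ordinal.lt_opow_of_isSuccLimit Ordinal.omega0_ne_zero hα).1 hδ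
      have := h β hβ
      rw [ih β hβ, mem_concatMultiples_iff (hω β)] at this
      -- Since ω^β divides ω^α, the position ω^α · γ also starts an ω^β-block, which contains the
      -- offset `δ`.
      obtain ⟨ε, hε⟩ := Ordinal.opow_dvd_opow Ordinal.omega0 hβ.le
      rw [hε, mul_assoc]
      exact this _ δ hδ
    · intro h β hβ
      rw [ih β hβ]
      rw [← mem_concatMultiples_iff (hω α)] at h
      obtain ⟨z, rfl⟩ := h
      obtain ⟨ε, hε⟩ := Ordinal.opow_dvd_opow Ordinal.omega0 hβ.le
      have hε0 : ε ≠ 0 := by rintro rfl; exact hω α (by rw [hε, mul_zero])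
      rw [hε, ← concatMul_concatMul (hω β) hε0]
      exact ⟨_, rfl⟩

end No

theorem proposition7p2 (α : Ordinal.{u}) :
    No.selfImbrication No.purelyInfinite α =
        No.concatMultiples (No.ofOrdinal (Ordinal.omega0 ^ α)) ∧
      No.IsFunctionGroup (No.translations (No.lengthBelow (Ordinal.omega0 ^ α))) ∧
      No.concatMultiples (No.ofOrdinal (Ordinal.omega0 ^ α)) =
        No.simpleElements (No.translations (No.lengthBelow (Ordinal.omega0 ^ α))) :=
  ⟨No.selfImbrication_purelyInfinite α, No.isFunctionGroup_translations_lengthBelow α,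
    No.concatMultiples_eq_simpleElements α⟩
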